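/- Let $a<b$ be real numbers and let $\gamma:[a,b]\to\mathbb{C}$ be an analytic simple arc: there are an open set $V\subseteq\mathbb{C}$ with $[a,b]\subseteq V$ and an injective holomorphic function $F:V\to\mathbb{C}$ with $F|_{[a,b]}=\gamma$. Fix any such $V$ and $F$, write $\gamma^*=\gamma([a,b])$, and put $$K(\gamma,+)=F(\{z\in V:\operatorname{Im} z>0\}),\qquad K(\gamma,-)=F(\{z\in V:\operatorname{Im} z<0\}).$$ For $k\in\{0,1,2,\dots\}\cup\{\infty\}$ let $C^k(\gamma^*)$ be the space of functions $u:\gamma^*\to\mathbb{C}$ such that $u\circ\gamma$ is $k$ times continuously differentiable on $[a,b]$, with the topology defined by the seminorms $u\mapsto\sup_{t\in[a,b]}|(u\circ\gamma)^{(l)}(t)|$, where $l$ runs over the integers with $0\le l\le k$ (over all $l\ge 0$ if $k=\infty$). For $K\in\{K(\gamma,+),K(\gamma,-)\}$ say that $u\in C^k(\gamma^*)$ is extendable from the side $K$ if there are a domain $W\subseteq\mathbb{C}$ with $W\cap\gamma^*\neq\emptyset$ and a continuous function $\lambda:\gamma^*\cup(W\cap K)\to\mathbb{C}$ that is holomorphic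 on $W\cap K$ and satisfies $\lambda=u$ on $W\cap\gamma^*$. Define the following subsets of $C^k(\gamma^*)$: - $U_2(\gamma^*,k)$: the functions that are not extendable from the side $K(\gamma,+)$; - $U_3(\gamma^*,k)$: the functions that are not extendable from the side $K(\gamma,-)$; - $U_4(\gamma^*,k)$: the functions that are extendable neither from the side $K(\gamma,+)$ nor from the side $K(\gamma,-)$; - $U_5(\gamma^*,k)$: the functions $u$ for which there are no $z_0\in\gamma^*$, $r>0$ and holomorphic $f:D(z_0,r)\to\mathbb{C}$ with $f=u$ on $D(z_0,r)\cap\gamma^*$, where $D(z_0,r)$ is the open disc with centre $z_0$ and radius $r$. Then, for every $k\in\{0,1,2,\dots\}\cup\{\infty\}$, each of $U_2(\gamma^*,k)$, $U_3(\gamma^*,k)$, $U_4(\gamma^*,k)$ and $U_5(\gamma^*,k)$ is a dense $G_\delta$ subset of $C^k(\gamma^*)$. -/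

import Mathlib

open Set

noncomputable section

namespace AnalyticArc

/-- `F : V → ℂ` exhibits `γ : [a,b] → ℂ` as an analytic simple curve: `V ⊆ ℂ` is an open set
containing `[a,b]`, `F` is holomorphic and injective on `V`, and `F = γ` on `[a,b]`.
(The values of `F` outside `V` are irrelevant.) -/
structure IsAnalyticExtension {a b : ℝ} (γ : Icc a b → ℂ) (V : Set ℂ) (F : ℂ → ℂ) : Prop where
  isOpen : IsOpen V
  mem : ∀ t : Icc a b, ((t : ℝ) : ℂ) ∈ V
  holomorphic : DifferentiableOn ℂ F V
  injective : InjOn F V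
  eq_curve : ∀ t : Icc a b, F ((t : ℝ) : ℂ) = γ t

variable {a b : ℝ}

/-- The function `u ∘ γ` on `[a,b]`, for `u` a function on the trace `γ* = range γ`. Only its
values on `[a,b]` matter below; it is continued by constants to a function on `ℝ`. -/
def pullback (hab : a < b) (γ : Icc a b → ℂ) (u : range γ → ℂ) : ℝ → ℂ :=
  IccExtend hab.le (fun t => u ⟨γ t, mem_range_self t⟩)

/-- The functions `u : γ* → ℂ` such that `u ∘ γ` is `k` times continuously differentiable
on `[a,b]` (one-sided derivatives at the end points), as a complex vector space. -/
def ckSubmodule (hab : a < b) (γ : Icc a b → ℂ) (k : ℕ∞) : Submodule ℂ (range γ → ℂ) where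
  carrier := {u | ContDiffOn ℝ k (pullback hab γ u) (Icc a b)}
  add_mem' := fun hu hv => ContDiffOn.add hu hv
  zero_mem' := contDiffOn_const (c := (0 : ℂ))
  smul_mem' := fun c _ hu => ContDiffOn.const_smul c hu

/-- The space `C^k(γ*)`, `k = 0, 1, 2, …` or `∞`. It is a type of its own, so that it does not
inherit the topology of pointwise convergence. -/
def Ck (hab : a < b) (γ : Icc a b → ℂ) (k : ℕ∞) : Type := ckSubmodule hab γ k

variable {hab : a < b} {γ : Icc a b → ℂ} {k : ℕ∞}

instance : AddCommGroup (Ck hab γ k) := inferInstanceAs (AddCommGroup (ckSubmodule hab γ k))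

instance : Module ℂ (Ck hab γ k) := inferInstanceAs (Module ℂ (ckSubmodule hab γ k))

/-- The function on `γ*` underlying an element of `C^k(γ*)`. -/
def Ck.toFun (u : Ck hab γ k) : range γ → ℂ := Subtype.val u

theorem Ck.contDiffOn (u : Ck hab γ k) : ContDiffOn ℝ k (pullback hab γ u.toFun) (Icc a b) :=
  Subtype.prop u

/-- The `l`-th derivative `(u ∘ γ)^(l)`, a continuous function on `[a,b]`, for `l ≤ k`. -/
def Ck.derivMap (l : {l : ℕ // (l : ℕ∞) ≤ k}) : Ck hab γ k →ₗ[ℂ] C(Icc a b, ℂ) where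
  toFun u :=
    { toFun := fun t => iteratedDerivWithin l (pullback hab γ u.toFun) (Icc a b) t
      continuous_toFun := continuousOn_iff_continuous_domRestrict.1
        (u.contDiffOn.continuousOn_iteratedDerivWithin
          (by exact_mod_cast l.2) (uniqueDiffOn_Icc hab)) }
  map_add' u v := by
    ext t
    have h : ((l : ℕ) : WithTop ℕ∞) ≤ (k : WithTop ℕ∞) := by exact_mod_cast l.2
    exact iteratedDerivWithin_add t.2 (uniqueDiffOn_Icc hab)
      ((u.contDiffOn.of_le h) t t.2) ((v.contDiffOn.of_le h) t t.2)
  map_smul' c u := by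
    ext t
    have h : ((l : ℕ) : WithTop ℕ∞) ≤ (k : WithTop ℕ∞) := by exact_mod_cast l.2
    exact iteratedDerivWithin_const_smul t.2 (uniqueDiffOn_Icc hab) c
      ((u.contDiffOn.of_le h) t t.2)

/-- The seminorms `u ↦ sup_{t ∈ [a,b]} |(u ∘ γ)^(l)(t)|`, `l ≤ k` (all `l` if `k = ∞`); the norm
of `C(Icc a b, ℂ)` is the maximum norm. -/
def Ck.seminorms (hab : a < b) (γ : Icc a b → ℂ) (k : ℕ∞) :
    SeminormFamily ℂ (Ck hab γ k) {l : ℕ // (l : ℕ∞) ≤ k} :=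
  fun l => (normSeminorm ℂ C(Icc a b, ℂ)).comp (Ck.derivMap l)

/-- The topology of `C^k(γ*)`: the one defined by the above seminorms. -/
instance : TopologicalSpace (Ck hab γ k) := (Ck.seminorms hab γ k).moduleFilterBasis.topology

/-- `K(γ,+) = F({Im z > 0} ∩ V)`. -/
def sidePlus (V : Set ℂ) (F : ℂ → ℂ) : Set ℂ := F '' ({z | 0 < z.im} ∩ V)

/-- `K(γ,-) = F({Im z < 0} ∩ V)`. -/
def sideMinus (V : Set ℂ) (F : ℂ → ℂ) : Set ℂ := F '' ({z | z.im < 0} ∩ V)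

/-- `u` is extendable from the side `K`: there are a domain `W` meeting `γ*` and a function `g`,
continuous on `γ* ∪ (W ∩ K)` and holomorphic on `W ∩ K`, with `g = u` on `W ∩ γ*`. -/
def ExtendableFromSide (γ : Icc a b → ℂ) (K : Set ℂ) (u : range γ → ℂ) : Prop :=
  ∃ W : Set ℂ, IsOpen W ∧ IsConnected W ∧ (W ∩ range γ).Nonempty ∧
    ∃ g : ℂ → ℂ, ContinuousOn g (range γ ∪ (W ∩ K)) ∧ DifferentiableOn ℂ g (W ∩ K) ∧
      ∀ z : range γ, (z : ℂ) ∈ W → g z = u z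

/-- `u` is extendable to a disc: there are a disc `D(z₀,r)`, `z₀ ∈ γ*`, `r > 0`, and a
holomorphic function `f` on it with `f = u` on `D(z₀,r) ∩ γ*`. -/
def ExtendableToDisc (γ : Icc a b → ℂ) (u : range γ → ℂ) : Prop :=
  ∃ z₀ ∈ range γ, ∃ r : ℝ, 0 < r ∧
    ∃ f : ℂ → ℂ, DifferentiableOn ℂ f (Metric.ball z₀ r) ∧
      ∀ z : range γ, (z : ℂ) ∈ Metric.ball z₀ r → f z = u z

/-- Functions in `C^k(γ*)` not extendable from the side `K(γ,+)`. -/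
def U₂ (hab : a < b) (γ : Icc a b → ℂ) (V : Set ℂ) (F : ℂ → ℂ) (k : ℕ∞) : Set (Ck hab γ k) :=
  {u | ¬ ExtendableFromSide γ (sidePlus V F) u.toFun}

/-- Functions in `C^k(γ*)` not extendable from the side `K(γ,-)`. -/
def U₃ (hab : a < b) (γ : Icc a b → ℂ) (V : Set ℂ) (F : ℂ → ℂ) (k : ℕ∞) : Set (Ck hab γ k) :=
  {u | ¬ ExtendableFromSide γ (sideMinus V F) u.toFun}

/-- Functions in `C^k(γ*)` extendable neither from `K(γ,+)` nor from `K(γ,-)`. -/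
def U₄ (hab : a < b) (γ : Icc a b → ℂ) (V : Set ℂ) (F : ℂ → ℂ) (k : ℕ∞) : Set (Ck hab γ k) :=
  {u | ¬ ExtendableFromSide γ (sidePlus V F) u.toFun ∧
    ¬ ExtendableFromSide γ (sideMinus V F) u.toFun}

/-- Functions in `C^k(γ*)` not extendable to any disc centred on `γ*`. -/
def U₅ (hab : a < b) (γ : Icc a b → ℂ) (k : ℕ∞) : Set (Ck hab γ k) :=
  {u | ¬ ExtendableToDisc γ u.toFun}

end AnalyticArc

end

/-!
Since `F` is biholomorphic from `V` onto `F(V)`, extendability of `u` from a side of the arc means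
that `u ∘ γ` extends from some segment of `[a, b]` to the half-disc on that side having the segment
as its diameter; for holomorphic extensions to a disc the half-disc is replaced by the whole disc.

For the `Gδ` property, rational centres and radii and integer bounds write the set of extendable
functions as a countable union of sets of functions with a bounded extension. The two-constants
estimate `‖G‖ ^ 4 ≤ sup_{diameter} ‖G‖ * (sup ‖G‖) ^ 3` on a smaller half-disc shows that a uniform
limit of such functions still has an extension to the smaller half-disc, so each of these sets may
be replaced by its closure.

For density, the functions extending from one fixed segment form a linear subspace. A function that
vanishes on a part of a segment but not on all of it is not extendable, so bumps lie outside these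
subspaces, and Baire's theorem, applied to the coefficients of a series of bumps, produces a smooth
function lying outside all of them. On every line in the direction of that function only countably
many points are extendable.
-/

open Set Filter Topology Metric

namespace AnalyticArc

theorem ofReal_mem_ball {x c r : ℝ} : (x : ℂ) ∈ ball (c : ℂ) r ↔ x ∈ ball c r := by
  rw [mem_ball, Complex.isometry_ofReal.dist_eq, mem_ball]

theorem neg_mem_ball {E : Type*} [SeminormedAddCommGroup E] {x c : E} {r : ℝ} :
    -x ∈ ball c r ↔ x ∈ ball (-c) r := by
  rw [← neg_ball, Set.mem_neg]

/-- The side of the real line picked out by a sign: the closed upper half-plane for `1`, the closed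
lower half-plane for `-1`, and the whole plane for `0`. The sign `0` makes extendability to a disc
a case of extendability from a side. -/
def closedSide (σ : SignType) : Set ℂ := {z | 0 ≤ (σ : ℝ) * z.im}

theorem closedSide_zero : closedSide 0 = univ := by simp [closedSide]

theorem closedSide_one : closedSide 1 = {z | 0 ≤ z.im} := by simp [closedSide]

theorem closedSide_neg_one : closedSide (-1) = {z | z.im ≤ 0} := by simp [closedSide]

theorem ofReal_mem_closedSide (σ : SignType) (x : ℝ) : (x : ℂ) ∈ closedSide σ := by
  simp [closedSide]

theorem isClosed_closedSide (σ : SignType) : IsClosed (closedSide σ) :=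
  isClosed_le (by fun_prop) (by fun_prop)

theorem convex_closedSide (σ : SignType) : Convex ℝ (closedSide σ) :=
  (convex_Ici 0).linear_preimage ((σ : ℝ) • Complex.imLm)

theorem closedSide_subset_closure_interior (σ : SignType) :
    closedSide σ ⊆ closure (interior (closedSide σ)) := by
  obtain rfl | rfl | rfl := σ.trichotomy
  · simp [closedSide_neg_one]
  · simp [closedSide_zero]
  · simp [closedSide_one]

theorem closedSide_neg (σ : SignType) : closedSide (-σ) = Homeomorph.neg ℂ ⁻¹' closedSide σ := by
  ext z
  simp [closedSide]

/-- `G` extends `v` to the part of the disc with centre `c` and radius `r` that lies on the side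
`σ` of the real line: it is continuous there, holomorphic off the boundary of that side, and
equal to `v` on the real diameter. -/
structure IsSideExtension (σ : SignType) (c r : ℝ) (v : ℝ → ℂ) (G : ℂ → ℂ) : Prop where
  continuousOn : ContinuousOn G (ball (c : ℂ) r ∩ closedSide σ)
  differentiableOn : DifferentiableOn ℂ G (ball (c : ℂ) r ∩ interior (closedSide σ))
  eq_ofReal : ∀ x ∈ ball c r, G x = v x

namespace IsSideExtension

variable {σ τ : SignType} {c r d s : ℝ} {v w : ℝ → ℂ} {G H : ℂ → ℂ}

theorem zero (σ : SignType) (c r : ℝ) : IsSideExtension σ c r 0 0 :=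
  ⟨continuousOn_const, differentiableOn_const 0, fun _ _ => rfl⟩

theorem add (hG : IsSideExtension σ c r v G) (hH : IsSideExtension σ c r w H) :
    IsSideExtension σ c r (v + w) (G + H) :=
  ⟨hG.continuousOn.add hH.continuousOn, hG.differentiableOn.add hH.differentiableOn,
    fun x hx => congr_arg₂ (· + ·) (hG.eq_ofReal x hx) (hH.eq_ofReal x hx)⟩

theorem const_smul (a : ℂ) (hG : IsSideExtension σ c r v G) :
    IsSideExtension σ c r (a • v) (a • G) :=
  ⟨hG.continuousOn.const_smul a, hG.differentiableOn.const_smul a,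
    fun x hx => congr_arg (a • ·) (hG.eq_ofReal x hx)⟩

theorem sub (hG : IsSideExtension σ c r v G) (hH : IsSideExtension σ c r w H) :
    IsSideExtension σ c r (v - w) (G - H) := by
  simpa [sub_eq_add_neg] using hG.add (hH.const_smul (-1))

theorem congr (hG : IsSideExtension σ c r v G) (h : EqOn v w (ball c r)) :
    IsSideExtension σ c r w G :=
  ⟨hG.continuousOn, hG.differentiableOn, fun x hx => (hG.eq_ofReal x hx).trans (h hx)⟩

theorem of_closedSide_subset (hG : IsSideExtension σ c r v G) (h : closedSide τ ⊆ closedSide σ) :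
    IsSideExtension τ c r v G :=
  ⟨hG.continuousOn.mono (inter_subset_inter_right _ h),
    hG.differentiableOn.mono (inter_subset_inter_right _ (interior_mono h)), hG.eq_ofReal⟩

theorem mono (hG : IsSideExtension σ c r v G) (h : s + dist d c ≤ r) :
    IsSideExtension σ d s v G := by
  have hball : ball (d : ℂ) s ⊆ ball (c : ℂ) r :=
    ball_subset_ball' (by rwa [Complex.isometry_ofReal.dist_eq])
  exact ⟨hG.continuousOn.mono (inter_subset_inter_left _ hball),
    hG.differentiableOn.mono (inter_subset_inter_left _ hball),
    fun x hx => hG.eq_ofReal x (ball_subset_ball' h hx)⟩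

theorem reflect (hG : IsSideExtension σ c r v G) :
    IsSideExtension (-σ) (-c) r (fun x => v (-x)) (fun z => G (-z)) := by
  have hball {z : ℂ} (hz : z ∈ ball ((-c : ℝ) : ℂ) r) : -z ∈ ball (c : ℂ) r := by
    rwa [neg_mem_ball, ← Complex.ofReal_neg]
  refine ⟨hG.continuousOn.comp (by fun_prop) fun z hz => ⟨hball hz.1, ?_⟩,
    hG.differentiableOn.comp (by fun_prop) fun z hz => ⟨hball hz.1, ?_⟩, fun x hx => ?_⟩
  · simpa [closedSide_neg] using hz.2
  · rw [closedSide_neg, ← Homeomorph.preimage_interior] at hz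
    exact hz.2
  · rw [← Complex.ofReal_neg]
    exact hG.eq_ofReal _ (by rwa [neg_mem_ball])

end IsSideExtension

section TwoConstants

variable {c ρ r s M ε : ℝ} {G : ℂ → ℂ} {z : ℂ}

theorem mem_closedBall_and_of_mem_frontier
    (hz : z ∈ frontier (ball (c : ℂ) ρ ∩ {w : ℂ | 0 < w.im})) :
    z ∈ closedBall (c : ℂ) ρ ∧ 0 ≤ z.im ∧ (z.im = 0 ∨ dist z c = ρ) := by
  have hopen : IsOpen (ball (c : ℂ) ρ ∩ {w : ℂ | 0 < w.im}) :=
    isOpen_ball.inter (isOpen_lt continuous_const Complex.continuous_im)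
  rw [hopen.frontier_eq] at hz
  have hball : z ∈ closedBall (c : ℂ) ρ :=
    closure_ball_subset_closedBall (closure_mono inter_subset_left hz.1)
  have him : 0 ≤ z.im := by
    simpa [Complex.closure_setOfPred_lt_im] using closure_mono inter_subset_right hz.1
  refine ⟨hball, him, ?_⟩
  by_contra! h
  exact hz.2 ⟨lt_of_le_of_ne hball h.2, lt_of_le_of_ne him h.1.symm⟩

/-- On the closed half-disc of radius `ρ`, the modulus of `exp ∘ weight` is at most `1` on the
half-circle, at most `exp (s * ρ ^ 2)` on the diameter, and at least `exp (s * ρ ^ 2 / 4)` on the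
concentric half-disc of radius `ρ / 4`. -/
def weight (c ρ s : ℝ) (z : ℂ) : ℂ := s * (ρ ^ 2 - (z - c) ^ 2 + 2 * Complex.I * ρ * (z - c))

theorem differentiable_weight (c ρ s : ℝ) : Differentiable ℂ (weight c ρ s) := by
  unfold weight
  fun_prop

theorem re_weight (c ρ s : ℝ) (z : ℂ) : (weight c ρ s z).re =
    s * (ρ ^ 2 + 2 * z.im ^ 2 - 2 * ρ * z.im - dist z c ^ 2) := by
  rw [Complex.dist_eq, Complex.sq_norm, Complex.normSq_apply, weight, Complex.re_ofReal_mul]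
  congr 1
  simp [sq]
  ring

theorem norm_mul_exp_le (hs : 0 ≤ s)
    (hc : ContinuousOn G (closedBall (c : ℂ) ρ ∩ {z | 0 ≤ z.im}))
    (hd : DifferentiableOn ℂ G (ball (c : ℂ) ρ ∩ {z | 0 < z.im}))
    (hM : ∀ z ∈ closedBall (c : ℂ) ρ ∩ {z | 0 ≤ z.im}, ‖G z‖ ≤ M)
    (hε : ∀ x : ℝ, dist x c ≤ ρ → ‖G x‖ * Real.exp (s * ρ ^ 2) ≤ M)
    (hz : z ∈ ball (c : ℂ) ρ ∩ {z | 0 < z.im}) :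
    ‖G z‖ * Real.exp (weight c ρ s z).re ≤ M := by
  have hclosure : closure (ball (c : ℂ) ρ ∩ {z | 0 < z.im}) ⊆
      closedBall (c : ℂ) ρ ∩ {z | 0 ≤ z.im} :=
    closure_inter_subset_inter_closure _ _ |>.trans
      (inter_subset_inter closure_ball_subset_closedBall (Complex.closure_setOfPred_lt_im 0).le)
  have hexp := (differentiable_weight c ρ s).cexp
  rw [← Complex.norm_exp, ← norm_mul]
  refine Complex.norm_le_of_forall_mem_frontier_norm_le (isBounded_ball.subset inter_subset_left)
    ⟨hd.mul hexp.differentiableOn, (hc.mono hclosure).mul hexp.continuous.continuousOn⟩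
    (fun w hw => ?_) (subset_closure hz)
  obtain ⟨hball, him, hor⟩ := mem_closedBall_and_of_mem_frontier hw
  rw [Pi.mul_apply, norm_mul, Complex.norm_exp, re_weight]
  rcases hor with hreal | hcircle
  · obtain ⟨x, rfl⟩ : ∃ x : ℝ, (x : ℂ) = w := ⟨w.re, Complex.ext rfl (by simp [hreal])⟩
    refine le_trans ?_ (hε x (by rwa [← Complex.isometry_ofReal.dist_eq]))
    gcongr
    simp
  · have hle : w.im ≤ ρ := by
      simpa [← hcircle, Complex.dist_eq] using
        (le_abs_self _).trans (Complex.abs_im_le_norm (w - c))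
    refine (mul_le_of_le_one_right (norm_nonneg _) (Real.exp_le_one_iff.2 ?_)).trans
      (hM w ⟨hball, him⟩)
    rw [hcircle]
    exact mul_nonpos_of_nonneg_of_nonpos hs (by nlinarith)

theorem norm_pow_four_le_of_pos_im (hε₀ : 0 < ε)
    (hc : ContinuousOn G (ball (c : ℂ) r ∩ {z | 0 ≤ z.im}))
    (hd : DifferentiableOn ℂ G (ball (c : ℂ) r ∩ {z | 0 < z.im}))
    (hM : ∀ z ∈ ball (c : ℂ) r ∩ {z | 0 ≤ z.im}, ‖G z‖ ≤ M)
    (hε : ∀ x : ℝ, x ∈ ball c r → ‖G x‖ ≤ ε) (hεM : ε ≤ M)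
    (hz : z ∈ ball (c : ℂ) (r / 4)) (him : 0 < z.im) : ‖G z‖ ^ 4 ≤ ε * M ^ 3 := by
  rw [mem_ball] at hz
  obtain ⟨ρ, hzρ, hρr⟩ := exists_between (show 4 * dist z c < r by linarith)
  have hdist := dist_nonneg (x := z) (y := (c : ℂ))
  have hM₀ : 0 < M := hε₀.trans_le hεM
  have hρ : 0 < ρ := by linarith
  have hsub : closedBall (c : ℂ) ρ ⊆ ball (c : ℂ) r := closedBall_subset_ball hρr
  obtain ⟨s, hs₀, hs⟩ : ∃ s, 0 ≤ s ∧ s * ρ ^ 2 = Real.log (M / ε) :=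
    ⟨Real.log (M / ε) / ρ ^ 2, div_nonneg (Real.log_nonneg ((one_le_div hε₀).2 hεM)) (sq_nonneg ρ),
      div_mul_cancel₀ _ (by positivity)⟩
  have hexp : Real.exp (s * ρ ^ 2) = M / ε := by rw [hs, Real.exp_log (by positivity)]
  have hkey : ‖G z‖ * Real.exp (weight c ρ s z).re ≤ M := by
    refine norm_mul_exp_le hs₀ (hc.mono (inter_subset_inter_left _ hsub))
      (hd.mono (inter_subset_inter_left _ (ball_subset_ball hρr.le)))
      (fun w hw => hM w ⟨hsub hw.1, hw.2⟩) (fun x hx => ?_) ⟨mem_ball.2 (by linarith), him⟩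
    rw [hexp, mul_div_assoc', div_le_iff₀ hε₀, mul_comm M]
    exact mul_le_mul_of_nonneg_right (hε x (hx.trans_lt hρr)) hM₀.le
  have hweight : s * ρ ^ 2 ≤ 4 * (weight c ρ s z).re := by
    have hle : z.im ≤ dist z c := by
      simpa [Complex.dist_eq] using (le_abs_self _).trans (Complex.abs_im_le_norm (z - c))
    rw [re_weight, mul_left_comm]
    exact mul_le_mul_of_nonneg_left (by nlinarith) hs₀
  have hpow : ‖G z‖ ^ 4 * (M / ε) ≤ M ^ 4 := calc
    ‖G z‖ ^ 4 * (M / ε) ≤ ‖G z‖ ^ 4 * Real.exp (weight c ρ s z).re ^ 4 := by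
      rw [← hexp, ← Real.exp_nat_mul]
      exact mul_le_mul_of_nonneg_left (Real.exp_le_exp.2 (by exact_mod_cast hweight))
        (by positivity)
    _ = (‖G z‖ * Real.exp (weight c ρ s z).re) ^ 4 := (mul_pow _ _ 4).symm
    _ ≤ M ^ 4 := by gcongr
  rw [mul_div_assoc', div_le_iff₀ hε₀] at hpow
  nlinarith

end TwoConstants

namespace IsSideExtension

variable {σ : SignType} {c d r s M ε : ℝ} {v : ℝ → ℂ} {G : ℂ → ℂ}

theorem norm_pow_four_le_of_im_nonneg (hG : IsSideExtension 1 c r v G) (hε₀ : 0 < ε)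
    (hM : ∀ z ∈ ball (c : ℂ) r ∩ closedSide 1, ‖G z‖ ≤ M) (hε : ∀ x ∈ ball c r, ‖v x‖ ≤ ε)
    {z : ℂ} (hz : z ∈ ball (c : ℂ) (r / 4)) (him : 0 ≤ z.im) : ‖G z‖ ^ 4 ≤ ε * M ^ 3 := by
  obtain ⟨hc, hd, heq⟩ := hG
  rw [closedSide_one] at hc hd hM
  rw [Complex.interior_setOfPred_le_im] at hd
  have hr : 0 < r / 4 := dist_nonneg.trans_lt hz
  have hzr : z ∈ ball (c : ℂ) r := ball_subset_ball (by linarith) hz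
  have hreal {x : ℝ} (hx : x ∈ ball c r) : ‖G x‖ ≤ ε := heq x hx ▸ hε x hx
  have hGM : ‖G z‖ ≤ M := hM z ⟨hzr, him⟩
  have hpow (h : ‖G z‖ ≤ ε) : ‖G z‖ ^ 4 ≤ ε * M ^ 3 := calc
    ‖G z‖ ^ 4 = ‖G z‖ * ‖G z‖ ^ 3 := pow_succ' _ _
    _ ≤ ε * M ^ 3 := by gcongr
  rcases lt_or_ge M ε with hMε | hMε
  · exact hpow (hGM.trans hMε.le)
  rcases him.eq_or_lt with him | him
  · obtain ⟨x, rfl⟩ : ∃ x : ℝ, (x : ℂ) = z := ⟨z.re, Complex.ext rfl (by simpa using him)⟩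
    exact hpow (hreal (ofReal_mem_ball.1 hzr))
  · exact norm_pow_four_le_of_pos_im hε₀ hc hd hM (fun x => hreal) hMε hz him

theorem norm_pow_four_le (hG : IsSideExtension σ c r v G) (hε₀ : 0 < ε)
    (hM : ∀ z ∈ ball (c : ℂ) r ∩ closedSide σ, ‖G z‖ ≤ M) (hε : ∀ x ∈ ball c r, ‖v x‖ ≤ ε)
    {z : ℂ} (hz : z ∈ ball (c : ℂ) (r / 4) ∩ closedSide σ) : ‖G z‖ ^ 4 ≤ ε * M ^ 3 := by
  have upper (h : closedSide 1 ⊆ closedSide σ) (him : 0 ≤ z.im) : ‖G z‖ ^ 4 ≤ ε * M ^ 3 :=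
    (hG.of_closedSide_subset h).norm_pow_four_le_of_im_nonneg hε₀
      (fun w hw => hM w ⟨hw.1, h hw.2⟩) hε hz.1 him
  have lower (h : closedSide (-1) ⊆ closedSide σ) (him : z.im ≤ 0) : ‖G z‖ ^ 4 ≤ ε * M ^ 3 := by
    have hreflect : IsSideExtension 1 (-c) r (fun x => v (-x)) (fun z => G (-z)) := by
      simpa using (hG.of_closedSide_subset h).reflect
    rw [← neg_neg z]
    refine hreflect.norm_pow_four_le_of_im_nonneg hε₀ (fun w hw => hM _ ⟨?_, h ?_⟩)
      (fun x hx => hε _ ?_) ?_ (by simpa using him)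
    · rw [neg_mem_ball, ← Complex.ofReal_neg]
      exact hw.1
    · rw [← neg_neg (1 : SignType), closedSide_neg] at hw
      exact hw.2
    · rwa [neg_mem_ball]
    · rw [neg_mem_ball, Complex.ofReal_neg, neg_neg]
      exact hz.1
  obtain rfl | rfl | rfl := σ.trichotomy
  · exact lower subset_rfl (closedSide_neg_one.le hz.2)
  · rw [closedSide_zero] at *
    exact (le_total 0 z.im).elim (upper (subset_univ _)) (lower (subset_univ _))
  · exact upper subset_rfl (closedSide_one.le hz.2)

theorem exists_norm_le (hG : IsSideExtension σ c r v G) (hs : s < r) :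
    ∃ M, ∀ z ∈ ball (c : ℂ) s ∩ closedSide σ, ‖G z‖ ≤ M := by
  have hcompact : IsCompact (closedBall (c : ℂ) s ∩ closedSide σ) :=
    (isCompact_closedBall _ _).inter_right (isClosed_closedSide σ)
  obtain ⟨M, hM⟩ := hcompact.exists_bound_of_continuousOn
    (hG.continuousOn.mono (inter_subset_inter_left _ (closedBall_subset_ball hs)))
  exact ⟨M, fun z hz => hM z ⟨ball_subset_closedBall hz.1, hz.2⟩⟩

theorem eqOn_zero_near (hG : IsSideExtension σ c r v G) (hs : s < r)
    (hv : EqOn v 0 (ball c s)) : EqOn G 0 (ball (c : ℂ) (s / 4) ∩ closedSide σ) := by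
  intro z hz
  obtain ⟨M, hM⟩ := hG.exists_norm_le hs
  by_contra hz₀
  obtain ⟨ε, hε, hlt⟩ := exists_pos_mul_lt (pow_pos (norm_pos_iff.2 hz₀) 4) (M ^ 3)
  rw [mul_comm] at hlt
  exact hlt.not_ge ((hG.mono (by simpa using hs.le)).norm_pow_four_le hε hM
    (fun x hx => by simp [hv hx, hε.le]) hz)

theorem eqOn_zero (hG : IsSideExtension σ c r v G) (hs : 0 < s) (h : s + dist d c ≤ r)
    (hv : EqOn v 0 (ball d s)) : EqOn v 0 (ball c r) := by
  have hnear : EqOn G 0 (ball (d : ℂ) (s / 8) ∩ closedSide σ) := by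
    convert (hG.mono h).eqOn_zero_near (half_lt_self hs)
      (hv.mono (ball_subset_ball (half_le_self hs.le))) using 3
    ring
  obtain ⟨z₀, hz₀, hz₀σ⟩ : (ball (d : ℂ) (s / 8) ∩ interior (closedSide σ)).Nonempty :=
    mem_closure_iff.1 (closedSide_subset_closure_interior σ (ofReal_mem_closedSide σ d))
      _ isOpen_ball (mem_ball_self (by positivity))
  have hball : ball (d : ℂ) (s / 8) ⊆ ball (c : ℂ) r :=
    ball_subset_ball' (by rw [Complex.isometry_ofReal.dist_eq]; linarith)
  have hinterior : EqOn G 0 (ball (c : ℂ) r ∩ interior (closedSide σ)) := by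
    refine (hG.differentiableOn.analyticOnNhd
      (isOpen_ball.inter isOpen_interior)).eqOn_zero_of_preconnected_of_eventuallyEq_zero
      ((convex_ball _ _).inter (convex_closedSide σ).interior).isPreconnected
      ⟨hball hz₀, hz₀σ⟩ ?_
    filter_upwards [isOpen_ball.mem_nhds hz₀, isOpen_interior.mem_nhds hz₀σ] with z hz hzσ
    exact hnear ⟨hz, interior_subset hzσ⟩
  have hall : EqOn G 0 (ball (c : ℂ) r ∩ closedSide σ) :=
    hinterior.of_subset_closure hG.continuousOn continuousOn_const
      (inter_subset_inter_right _ interior_subset)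
      ((inter_subset_inter_right _ (closedSide_subset_closure_interior σ)).trans
        isOpen_ball.inter_closure)
  intro x hx
  rw [← hG.eq_ofReal x hx]
  exact hall ⟨ofReal_mem_ball.2 hx, ofReal_mem_closedSide σ x⟩

theorem uniformCauchySeqOn {v : ℕ → ℝ → ℂ} {G : ℕ → ℂ → ℂ}
    (hG : ∀ n, IsSideExtension σ c r (v n) (G n))
    (hM : ∀ n, ∀ z ∈ ball (c : ℂ) r ∩ closedSide σ, ‖G n z‖ ≤ M)
    (hv : UniformCauchySeqOn v atTop (ball c r)) :
    UniformCauchySeqOn G atTop (ball (c : ℂ) (r / 4) ∩ closedSide σ) := by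
  rw [Metric.uniformCauchySeqOn_iff] at hv ⊢
  intro δ hδ
  obtain ⟨ε, hε, hεδ⟩ := exists_pos_mul_lt (pow_pos hδ 4) ((M + M) ^ 3)
  rw [mul_comm] at hεδ
  obtain ⟨N, hN⟩ := hv ε hε
  refine ⟨N, fun m hm n hn z hz => ?_⟩
  have hpow : ‖(G m - G n) z‖ ^ 4 ≤ ε * (M + M) ^ 3 :=
    ((hG m).sub (hG n)).norm_pow_four_le hε
      (fun w hw => (norm_sub_le _ _).trans (add_le_add (hM m w hw) (hM n w hw)))
      (fun x hx => by simpa [dist_eq_norm] using (hN m hm n hn x hx).le) hz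
  rw [dist_eq_norm]
  exact lt_of_pow_lt_pow_left₀ 4 hδ.le (hpow.trans_lt hεδ)

theorem exists_of_tendstoUniformlyOn (hr : 0 < r) {v : ℕ → ℝ → ℂ} {G : ℕ → ℂ → ℂ} {w : ℝ → ℂ}
    (hG : ∀ n, IsSideExtension σ c r (v n) (G n))
    (hM : ∀ n, ∀ z ∈ ball (c : ℂ) r ∩ closedSide σ, ‖G n z‖ ≤ M)
    (hv : TendstoUniformlyOn v w atTop (ball c r)) :
    ∃ H, IsSideExtension σ c (r / 4) w H := by
  have hcauchy := uniformCauchySeqOn hG hM hv.uniformCauchySeqOn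
  have hcomplete (z : ℂ) : ∃ a, z ∈ ball (c : ℂ) (r / 4) ∩ closedSide σ →
      Tendsto (fun n => G n z) atTop (𝓝 a) := by
    by_cases hz : z ∈ ball (c : ℂ) (r / 4) ∩ closedSide σ
    · exact (cauchySeq_tendsto_of_complete (hcauchy.cauchySeq hz)).imp fun a ha _ => ha
    · exact ⟨0, fun h => absurd h hz⟩
  choose H hH using hcomplete
  have hlim := hcauchy.tendstoUniformlyOn_of_tendsto hH
  have hmono (n : ℕ) : IsSideExtension σ c (r / 4) (v n) (G n) :=
    (hG n).mono (by simpa using (div_le_self hr.le (by norm_num)))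
  refine ⟨H, hlim.continuousOn (Frequently.of_forall fun n => (hmono n).continuousOn), ?_, ?_⟩
  · exact (hlim.mono (inter_subset_inter_right _ interior_subset)).tendstoLocallyUniformlyOn
      |>.differentiableOn (Eventually.of_forall fun n => (hmono n).differentiableOn)
        (isOpen_ball.inter isOpen_interior)
  · intro x hx
    have hxr : x ∈ ball c r := ball_subset_ball (by linarith) hx
    refine tendsto_nhds_unique (hH x ⟨ofReal_mem_ball.2 hx, ofReal_mem_closedSide σ x⟩) ?_
    simpa only [(hG _).eq_ofReal x hxr] using hv.tendsto_at hxr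

end IsSideExtension

/-- The functions that have an extension to the side `σ` of the disc with centre `c` and
radius `r`. -/
def extendable (σ : SignType) (c r : ℝ) : Submodule ℂ (ℝ → ℂ) where
  carrier := {v | ∃ G, IsSideExtension σ c r v G}
  zero_mem' := ⟨0, .zero σ c r⟩
  add_mem' := fun ⟨_, hG⟩ ⟨_, hH⟩ => ⟨_, hG.add hH⟩
  smul_mem' := fun a _ ⟨_, hG⟩ => ⟨_, hG.const_smul a⟩

/-- The functions that have an extension bounded by `M` to the side `σ` of the disc with centre
`c` and radius `r`. -/
def boundedlyExtendable (σ : SignType) (c r M : ℝ) : Set (ℝ → ℂ) :=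
  {v | ∃ G, IsSideExtension σ c r v G ∧ ∀ z ∈ ball (c : ℂ) r ∩ closedSide σ, ‖G z‖ ≤ M}

section Extendable

variable {σ : SignType} {c r M : ℝ} {v w : ℝ → ℂ}

theorem mem_extendable_congr (h : EqOn v w (ball c r)) :
    v ∈ extendable σ c r ↔ w ∈ extendable σ c r :=
  ⟨fun ⟨G, hG⟩ => ⟨G, hG.congr h⟩, fun ⟨G, hG⟩ => ⟨G, hG.congr h.symm⟩⟩

theorem boundedlyExtendable_subset_extendable : boundedlyExtendable σ c r M ⊆ extendable σ c r :=
  fun _ ⟨G, hG, _⟩ => ⟨G, hG⟩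

theorem mem_extendable_of_tendstoUniformlyOn (hr : 0 < r) {v : ℕ → ℝ → ℂ}
    (hv : ∀ n, v n ∈ boundedlyExtendable σ c r M)
    (hlim : TendstoUniformlyOn v w atTop (ball c r)) : w ∈ extendable σ c (r / 4) := by
  choose G hG hM using hv
  exact IsSideExtension.exists_of_tendstoUniformlyOn hr hG hM hlim

theorem exists_rat_mem_boundedlyExtendable (hv : v ∈ extendable σ c r) (hr : 0 < r) :
    ∃ (d s : ℚ) (M : ℕ), 0 < s ∧ s + dist (d : ℝ) c ≤ r ∧ v ∈ boundedlyExtendable σ d s M := by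
  obtain ⟨G, hG⟩ := hv
  obtain ⟨s, hs₀, hsr⟩ := exists_rat_btwn (show (0 : ℝ) < r / 2 by linarith)
  obtain ⟨d, hd⟩ := Rat.denseRange_cast.exists_dist_lt c (half_pos hr)
  rw [dist_comm] at hd
  obtain ⟨M, hM⟩ := (hG.mono (d := d) (s := r / 2) (by linarith)).exists_norm_le hsr
  obtain ⟨N, hN⟩ := exists_nat_ge M
  exact ⟨d, s, N, by exact_mod_cast hs₀, by linarith, G, hG.mono (by linarith),
    fun z hz => (hM z hz).trans hN⟩

end Extendable

section Condensation

open scoped BoundedContinuousFunction ContDiff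

variable {X E F : Type*} [NormedAddCommGroup E] [NormedSpace ℝ E] [NormedAddCommGroup F]
  [NormedSpace ℝ F]

theorem exists_pos_smul_iteratedFDeriv_le {f : E → F} (hf : ContDiff ℝ ∞ f)
    (hs : HasCompactSupport f) (n : ℕ) {δ : ℝ} (hδ : 0 < δ) :
    ∃ a : ℝ, 0 < a ∧ ∀ k ≤ n, ∀ x, ‖iteratedFDeriv ℝ k (a • f) x‖ ≤ δ := by
  choose C hC using fun k : ℕ => (hs.iteratedFDeriv k).exists_bound_of_continuous
    (hf.continuous_iteratedFDeriv (by exact_mod_cast le_top))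
  obtain ⟨D, hD⟩ := ((finite_Iic n).image C).bddAbove
  obtain ⟨a, ha, hlt⟩ := exists_pos_mul_lt hδ D
  refine ⟨a, ha, fun k hk x => ?_⟩
  rw [iteratedFDeriv_const_smul_apply (hf.contDiffAt.of_le (by exact_mod_cast le_top)), norm_smul,
    Real.norm_of_nonneg ha.le, mul_comm]
  exact (mul_le_mul_of_nonneg_right ((hC k x).trans (hD (mem_image_of_mem C hk))) ha.le).trans
    hlt.le

theorem norm_smul_le_geometric {ψ : ℕ → X → F} (hψ : ∀ n x, ‖ψ n x‖ ≤ (1 / 2) ^ n) (t : ℕ →ᵇ ℝ)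
    (x : X) (n : ℕ) : ‖t n • ψ n x‖ ≤ ‖t‖ * (1 / 2) ^ n := by
  rw [norm_smul]
  exact mul_le_mul (t.norm_coe_le_norm n) (hψ n x) (norm_nonneg _) (norm_nonneg _)

variable [CompleteSpace F]

theorem summable_smul_of_geometric {ψ : ℕ → X → F} (hψ : ∀ n x, ‖ψ n x‖ ≤ (1 / 2) ^ n)
    (t : ℕ →ᵇ ℝ) (x : X) : Summable fun n => t n • ψ n x :=
  .of_norm_bounded (summable_geometric_two.mul_left _) (norm_smul_le_geometric hψ t x)

/-- The series `∑ tₙ ψₙ` as a function of its bounded sequence of coefficients. -/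
noncomputable def seriesMap (ψ : ℕ → X → F) (hψ : ∀ n x, ‖ψ n x‖ ≤ (1 / 2) ^ n) :
    (ℕ →ᵇ ℝ) →ₗ[ℝ] X → F where
  toFun t x := ∑' n, t n • ψ n x
  map_add' s t := by
    ext x
    simp only [BoundedContinuousFunction.add_apply, add_smul]
    exact (summable_smul_of_geometric hψ s x).tsum_add (summable_smul_of_geometric hψ t x)
  map_smul' a t := by
    ext x
    simp only [BoundedContinuousFunction.smul_apply, smul_assoc]
    exact (summable_smul_of_geometric hψ t x).tsum_const_smul a

theorem norm_seriesMap_le {ψ : ℕ → X → F} (hψ : ∀ n x, ‖ψ n x‖ ≤ (1 / 2) ^ n) (t : ℕ →ᵇ ℝ) (x : X) :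
    ‖seriesMap ψ hψ t x‖ ≤ ‖t‖ * 2 := by
  refine (tsum_of_norm_bounded (summable_geometric_two.mul_left ‖t‖).hasSum
    (norm_smul_le_geometric hψ t x)).trans_eq ?_
  rw [tsum_mul_left, tsum_geometric_two]

theorem contDiff_seriesMap {ψ : ℕ → E → F} (hψ : ∀ n x, ‖ψ n x‖ ≤ (1 / 2) ^ n)
    (hsmooth : ∀ n, ContDiff ℝ ∞ (ψ n))
    (hderiv : ∀ n, ∀ k ≤ n, ∀ x, ‖iteratedFDeriv ℝ k (ψ n) x‖ ≤ (1 / 2) ^ n) (t : ℕ →ᵇ ℝ) :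
    ContDiff ℝ ∞ (seriesMap ψ hψ t) := by
  refine contDiff_tsum_of_eventually (f := fun n => t n • ψ n) (v := fun _ n => ‖t‖ * (1 / 2) ^ n)
    (fun n => (hsmooth n).const_smul (t n)) (fun _ _ => summable_geometric_two.mul_left ‖t‖)
    fun k _ => ?_
  rw [Nat.cofinite_eq_atTop]
  filter_upwards [eventually_ge_atTop k] with n hn x
  rw [iteratedFDeriv_const_smul_apply ((hsmooth n).contDiffAt.of_le (by exact_mod_cast le_top)),
    norm_smul]
  exact mul_le_mul (t.norm_coe_le_norm n) (hderiv n k hn x) (norm_nonneg _) (norm_nonneg _)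

theorem exists_seriesMap_eq {ψ : ℕ → X → F} (hψ : ∀ n x, ‖ψ n x‖ ≤ (1 / 2) ^ n) (n : ℕ) :
    ∃ t, seriesMap ψ hψ t = ψ n := by
  have hbound (m : ℕ) : ‖(Pi.single n 1 : ℕ → ℝ) m‖ ≤ 1 := by
    rcases eq_or_ne m n with rfl | h <;> simp [*]
  refine ⟨.ofNormedAddCommGroupDiscrete (Pi.single n 1) 1 hbound, ?_⟩
  ext x
  refine (tsum_eq_single n fun m hm => ?_).trans ?_ <;> simp [*]

theorem exists_linearMap_contDiff {f : ℕ → E → F} (hf : ∀ n, ContDiff ℝ ∞ (f n))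
    (hs : ∀ n, HasCompactSupport (f n)) :
    ∃ Φ : (ℕ →ᵇ ℝ) →ₗ[ℝ] E → F, (∀ t, ContDiff ℝ ∞ (Φ t)) ∧ (∀ t x, ‖Φ t x‖ ≤ ‖t‖ * 2) ∧
      ∀ n, ∃ t, ∃ a : ℝ, a ≠ 0 ∧ Φ t = a • f n := by
  choose a ha hderiv using fun n => exists_pos_smul_iteratedFDeriv_le (hf n) (hs n) n
    (δ := (1 / 2) ^ n) (by positivity)
  have hψ (n : ℕ) (x : E) : ‖(a n • f n) x‖ ≤ (1 / 2) ^ n := by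
    simpa using hderiv n 0 (Nat.zero_le n) x
  refine ⟨seriesMap (fun n => a n • f n) hψ,
    contDiff_seriesMap hψ (fun n => (hf n).const_smul (a n)) hderiv, norm_seriesMap_le hψ,
    fun n => ?_⟩
  obtain ⟨t, ht⟩ := exists_seriesMap_eq hψ n
  exact ⟨t, a n, (ha n).ne', ht⟩

/-- Baire's theorem on the Banach space of coefficients of a series makes up for the lack of a
complete norm on the space of smooth functions. -/
theorem exists_contDiff_forall_notMem {ι : Type*} [Countable ι] {S : ι → Set (E → F)}
    {p : ι → Submodule ℝ (E → F)}
    (hlim : ∀ i (v : ℕ → E → F) w, (∀ n, v n ∈ S i) → TendstoUniformly v w atTop → w ∈ p i)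
    (hp : ∀ i, ∃ f, ContDiff ℝ ∞ f ∧ HasCompactSupport f ∧ f ∉ p i) :
    ∃ v, ContDiff ℝ ∞ v ∧ ∀ i, v ∉ S i := by
  cases isEmpty_or_nonempty ι with
  | inl _ => exact ⟨0, contDiff_const, isEmptyElim⟩
  | inr _ =>
    obtain ⟨e, he⟩ := exists_surjective_nat ι
    choose f hf hs hfp using hp
    obtain ⟨Φ, hsmooth, hnorm, hΦ⟩ :=
      exists_linearMap_contDiff (fun n => hf (e n)) (fun n => hs (e n))
    have hclosure (i : ι) : closure (Φ ⁻¹' S i) ⊆ (p i).comap Φ := by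
      intro t ht
      obtain ⟨s, hs, hst⟩ := mem_closure_iff_seq_limit.1 ht
      refine hlim i _ _ hs (Metric.tendstoUniformly_iff.2 fun ε hε => ?_)
      filter_upwards [Metric.tendsto_nhds.1 hst (ε / 2) (half_pos hε)] with n hn x
      rw [dist_eq_norm, ← Pi.sub_apply, ← map_sub]
      rw [dist_comm, dist_eq_norm] at hn
      linarith [hnorm (t - s n) x]
    by_contra! hcon
    have hcover : ⋃ i, closure (Φ ⁻¹' S i) = univ := eq_univ_of_forall fun t =>
      mem_iUnion.2 ((hcon (Φ t) (hsmooth t)).imp fun i hi => subset_closure hi)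
    obtain ⟨i, hi⟩ := nonempty_interior_of_iUnion_of_closed (fun i => isClosed_closure) hcover
    have htop : (p i).comap Φ = ⊤ :=
      Submodule.eq_top_of_nonempty_interior' _ (hi.mono (interior_mono (hclosure i)))
    obtain ⟨n, rfl⟩ := he i
    obtain ⟨t, a, ha, hta⟩ := hΦ n
    have ht : Φ t ∈ p (e n) := Submodule.mem_comap.1 (htop ▸ Submodule.mem_top)
    rw [hta, Submodule.smul_mem_iff _ ha] at ht
    exact hfp _ ht

end Condensation

theorem exists_contDiff_notMem_extendable (σ : SignType) (c : ℝ) {r : ℝ} (hr : 0 < r) :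
    ∃ f : ℝ → ℂ, ContDiff ℝ (⊤ : ℕ∞) f ∧ HasCompactSupport f ∧ f ∉ extendable σ c r := by
  let B : ContDiffBump c := ⟨r / 4, r / 2, by positivity, by linarith⟩
  refine ⟨fun x => (B x : ℂ), Complex.ofRealCLM.contDiff.comp B.contDiff,
    B.hasCompactSupport.comp_left Complex.ofReal_zero, fun ⟨G, hG⟩ => ?_⟩
  have hzero : EqOn (fun x => (B x : ℂ)) 0 (ball c r) := by
    have hdist : dist (c + 3 / 4 * r) c = 3 / 4 * r := by simp [abs_of_pos hr]
    refine hG.eqOn_zero (d := c + 3 / 4 * r) (s := r / 4) (by positivity) (by linarith)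
      fun x hx => ?_
    have hle : r / 2 ≤ dist x c := by
      linarith [mem_ball.1 hx, dist_triangle_left (c + 3 / 4 * r) c x]
    simp [B.zero_of_le_dist hle]
  have hone : B c = 1 := B.one_of_mem_closedBall (mem_closedBall_self B.rIn_pos.le)
  simpa [hone] using hzero (mem_ball_self hr)

theorem exists_contDiff_forall_notMem_extendable :
    ∃ v : ℝ → ℂ, ContDiff ℝ (⊤ : ℕ∞) v ∧ ∀ σ c r, 0 < r → v ∉ extendable σ c r := by
  obtain ⟨v, hv, hvS⟩ := exists_contDiff_forall_notMem
    (ι := {i : SignType × ℚ × ℚ × ℕ // 0 < i.2.2.1})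
    (S := fun i => boundedlyExtendable i.1.1 i.1.2.1 i.1.2.2.1 i.1.2.2.2)
    (p := fun i => (extendable i.1.1 i.1.2.1 (i.1.2.2.1 / 4)).restrictScalars ℝ)
    (fun i v w hv hlim => mem_extendable_of_tendstoUniformlyOn (by exact_mod_cast i.2) hv
      hlim.tendstoUniformlyOn)
    (fun i => exists_contDiff_notMem_extendable _ _ (by have := i.2; positivity))
  refine ⟨v, hv, fun σ c r hr hvr => ?_⟩
  obtain ⟨d, s, M, hs, -, hmem⟩ := exists_rat_mem_boundedlyExtendable hvr hr
  exact hvS ⟨(σ, d, s, M), hs⟩ hmem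

section InjectiveHolomorphic

variable {U V : Set ℂ} {F Φ : ℂ → ℂ} {z : ℂ}

theorem not_eventually_eq_of_injOn (hi : InjOn F V) (hV : V ∈ 𝓝 z) :
    ¬ ∀ᶠ w in 𝓝 z, F w = F z := by
  intro h
  have hne : ∀ᶠ w in 𝓝[≠] z, (F w = F z ∧ w ∈ V) ∧ w ≠ z :=
    ((h.and hV).filter_mono nhdsWithin_le_nhds).and self_mem_nhdsWithin
  obtain ⟨w, ⟨hw, hwV⟩, hwz⟩ := hne.exists
  exact hwz (hi hwV (mem_of_mem_nhds hV) hw)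

theorem nhds_le_map_nhds_of_injOn (hd : DifferentiableOn ℂ F V) (hi : InjOn F V)
    (hV : V ∈ 𝓝 z) : 𝓝 (F z) ≤ map F (𝓝 z) :=
  (hd.analyticAt hV).eventually_constant_or_nhds_le_map_nhds.resolve_left
    (not_eventually_eq_of_injOn hi hV)

theorem isOpen_image_of_injOn (hd : DifferentiableOn ℂ F V) (hi : InjOn F V) (hU : IsOpen U)
    (hUV : U ⊆ V) : IsOpen (F '' U) := by
  rw [isOpen_iff_mem_nhds]
  rintro _ ⟨z, hz, rfl⟩
  exact nhds_le_map_nhds_of_injOn hd hi (mem_of_superset (hU.mem_nhds hz) hUV)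
    (image_mem_map (hU.mem_nhds hz))

theorem eventually_deriv_ne_zero_of_injOn (hd : DifferentiableOn ℂ F V) (hi : InjOn F V)
    (hV : V ∈ 𝓝 z) : ∀ᶠ w in 𝓝[≠] z, deriv F w ≠ 0 := by
  refine (hd.analyticAt hV).deriv.eventually_eq_zero_or_eventually_ne_zero.resolve_left
    fun h => not_eventually_eq_of_injOn hi hV ?_
  obtain ⟨δ, hδ, hball⟩ := eventually_nhds_iff_ball.1 (h.and hV)
  filter_upwards [ball_mem_nhds z hδ] with w hw
  exact isOpen_ball.is_const_of_deriv_eq_zero (convex_ball z δ).isPreconnected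
    (hd.mono fun y hy => (hball y hy).2) (fun y hy => (hball y hy).1) hw (mem_ball_self hδ)

theorem tendsto_leftInverse (hd : DifferentiableOn ℂ F V) (hi : InjOn F V)
    (hΦ : LeftInvOn Φ F V) (hV : V ∈ 𝓝 z) : Tendsto Φ (𝓝 (F z)) (𝓝 z) := by
  refine Tendsto.mono_left (tendsto_map'_iff.2 (tendsto_id.congr' ?_))
    (nhds_le_map_nhds_of_injOn hd hi hV)
  filter_upwards [hV] with w hw using (hΦ hw).symm

/-- Injectivity is not used to exclude zeros of `F'`: they are isolated, so their images are
removable singularities of the inverse. -/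
theorem differentiableOn_leftInverse (hV : IsOpen V) (hd : DifferentiableOn ℂ F V)
    (hi : InjOn F V) (hΦ : LeftInvOn Φ F V) : DifferentiableOn ℂ Φ (F '' V) := by
  have hopen : IsOpen (F '' V) := isOpen_image_of_injOn hd hi hV subset_rfl
  have hright : RightInvOn Φ F (F '' V) := hΦ.rightInvOn_image
  rintro _ ⟨z, hz, rfl⟩
  have htendsto := tendsto_leftInverse hd hi hΦ (hV.mem_nhds hz)
  have hmem : ∀ᶠ w in 𝓝[≠] (F z), w ∈ F '' V :=
    (hopen.eventually_mem (mem_image_of_mem F hz)).filter_mono nhdsWithin_le_nhds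
  have hpunctured : Tendsto Φ (𝓝[≠] (F z)) (𝓝[≠] z) := by
    refine tendsto_nhdsWithin_iff.2 ⟨htendsto.mono_left nhdsWithin_le_nhds, ?_⟩
    filter_upwards [self_mem_nhdsWithin, hmem] with w hwz hw h
    exact hwz ((hright hw).symm.trans (congr_arg F h))
  refine (Complex.analyticAt_of_differentiable_on_punctured_nhds_of_continuousAt ?_
    (by rwa [ContinuousAt, hΦ hz])).differentiableAt.differentiableWithinAt
  filter_upwards [hpunctured.eventually
    (eventually_deriv_ne_zero_of_injOn hd hi (hV.mem_nhds hz)), hmem] with _ hw ⟨y, hy, hyw⟩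
  subst hyw
  rw [hΦ hy] at hw
  refine (HasDerivAt.of_local_left_inverse (f := F) (f' := deriv F y) ?_ ?_ hw ?_).differentiableAt
  · rw [ContinuousAt, hΦ hy]
    exact tendsto_leftInverse hd hi hΦ (hV.mem_nhds hy)
  · rw [hΦ hy]
    exact (hd.differentiableAt (hV.mem_nhds hy)).hasDerivAt
  · filter_upwards [hopen.mem_nhds (mem_image_of_mem F hy)] with w hw using hright hw

end InjectiveHolomorphic

section Transfer

theorem mem_interior_closedSide_or_exists_ofReal {σ : SignType} {z : ℂ} (hz : z ∈ closedSide σ) :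
    z ∈ interior (closedSide σ) ∨ ∃ x : ℝ, (x : ℂ) = z := by
  rcases eq_or_ne z.im 0 with him | him
  · exact .inr ⟨z.re, Complex.ext rfl him.symm⟩
  left
  obtain rfl | rfl | rfl := σ.trichotomy
  · rw [closedSide_neg_one] at hz ⊢
    rw [Complex.interior_setOfPred_im_le]
    exact lt_of_le_of_ne hz him
  · simp [closedSide_zero]
  · rw [closedSide_one] at hz ⊢
    rw [Complex.interior_setOfPred_le_im]
    exact lt_of_le_of_ne hz him.symm

/-- The side of the arc corresponding to the sign `σ`: `K(γ,+)` for `1`, `K(γ,-)` for `-1`, and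
the whole of `F(V)` for `0`. -/
def side (σ : SignType) (V : Set ℂ) (F : ℂ → ℂ) : Set ℂ := F '' (interior (closedSide σ) ∩ V)

theorem side_zero (V : Set ℂ) (F : ℂ → ℂ) : side 0 V F = F '' V := by
  simp [side, closedSide_zero]

theorem side_one (V : Set ℂ) (F : ℂ → ℂ) : side 1 V F = sidePlus V F := by
  rw [side, sidePlus, closedSide_one, Complex.interior_setOfPred_le_im]

theorem side_neg_one (V : Set ℂ) (F : ℂ → ℂ) : side (-1) V F = sideMinus V F := by
  rw [side, sideMinus, closedSide_neg_one, Complex.interior_setOfPred_im_le]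

theorem exists_continuousOn_union_extension {X Y : Type*} [TopologicalSpace X] [TopologicalSpace Y]
    {R T C O : Set X} (hC : IsClosed C) (hO : IsOpen O) (hTC : T ⊆ C) (hCO : C ⊆ O) {u : R → Y}
    (hu : Continuous u) {h : X → Y} (hh : ContinuousOn h ((R ∪ T) ∩ O))
    (heq : ∀ x : R, (x : X) ∈ O → h x = u x) :
    ∃ g : X → Y, ContinuousOn g (R ∪ T) ∧ EqOn g h T ∧ ∀ x : R, g x = u x := by
  classical
  let e : X → Y := Function.extend Subtype.val u h
  have he (x : R) : e x = u x := Subtype.val_injective.extend_apply u h x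
  have hec : ContinuousOn e R :=
    continuousOn_iff_continuous_domRestrict.2 (hu.congr fun x => (he x).symm)
  let g : X → Y := O.piecewise h e
  have hgh : EqOn g h O := O.piecewise_eqOn h e
  have hge (x : R) : g x = u x := by
    by_cases hx : (x : X) ∈ O
    · exact (hgh hx).trans (heq x hx)
    · exact (O.piecewise_eq_of_notMem h e hx).trans (he x)
  refine ⟨g, continuousOn_of_locally_continuousOn fun x _ => ?_,
    hgh.mono (hTC.trans hCO), hge⟩
  by_cases hxO : x ∈ O
  · exact ⟨O, hO, hxO, hh.congr (hgh.mono inter_subset_right)⟩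
  · have hsub : (R ∪ T) ∩ Cᶜ ⊆ R := fun y hy => hy.1.resolve_right fun hyT => hy.2 (hTC hyT)
    exact ⟨Cᶜ, hC.isOpen_compl, fun hxC => hxO (hCO hxC),
      (hec.mono hsub).congr fun y hy => (hge ⟨y, hsub hy⟩).trans (he ⟨y, hsub hy⟩).symm⟩

theorem exists_ball_subset_Icc {a b t : ℝ} (hab : a < b) (ht : t ∈ Icc a b) {N : Set ℂ}
    (hN : N ∈ 𝓝 (t : ℂ)) : ∃ c r, 0 < r ∧ ball c r ⊆ Icc a b ∧ ball (c : ℂ) r ⊆ N := by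
  have hN' : interior N ∈ 𝓝 (t : ℂ) := interior_mem_nhds.2 hN
  have ht' : t ∈ closure (Ioo a b) := by rwa [closure_Ioo hab.ne]
  obtain ⟨c, hcN, hc⟩ := mem_closure_iff_nhds.1 ht' _
    (Complex.continuous_ofReal.continuousAt.preimage_mem_nhds hN')
  obtain ⟨r₁, hr₁, h₁⟩ := Metric.isOpen_iff.1 isOpen_Ioo c hc
  obtain ⟨r₂, hr₂, h₂⟩ := Metric.isOpen_iff.1 isOpen_interior (c : ℂ) hcN
  exact ⟨c, min r₁ r₂, lt_min hr₁ hr₂,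
    (ball_subset_ball (min_le_left _ _)).trans (h₁.trans Ioo_subset_Icc_self),
    (ball_subset_ball (min_le_right _ _)).trans (h₂.trans interior_subset)⟩

variable {a b : ℝ} {γ : Icc a b → ℂ} {V U : Set ℂ} {F : ℂ → ℂ}

theorem pullback_coe (hab : a < b) (u : range γ → ℂ) (t : Icc a b) :
    pullback hab γ u t = u ⟨γ t, mem_range_self t⟩ :=
  IccExtend_val hab.le _ t

namespace IsAnalyticExtension

theorem continuous_curve (hF : IsAnalyticExtension γ V F) : Continuous γ :=
  (hF.holomorphic.continuousOn.comp_continuous (by fun_prop) hF.mem).congr hF.eq_curve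

theorem injective_curve (hF : IsAnalyticExtension γ V F) : Function.Injective γ := by
  intro s t h
  rw [← hF.eq_curve, ← hF.eq_curve] at h
  exact Subtype.ext (Complex.ofReal_injective (hF.injective (hF.mem s) (hF.mem t) h))

theorem range_subset_image (hF : IsAnalyticExtension γ V F) : range γ ⊆ F '' V :=
  range_subset_iff.2 fun t => ⟨t, hF.mem t, hF.eq_curve t⟩

theorem curve_mem_image_iff (hF : IsAnalyticExtension γ V F) (hU : U ⊆ V) {t : Icc a b} :
    γ t ∈ F '' U ↔ ((t : ℝ) : ℂ) ∈ U := by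
  rw [← hF.eq_curve, hF.injective.mem_image_iff hU (hF.mem t)]

theorem image_inter_side (hF : IsAnalyticExtension γ V F) (hU : U ⊆ V) (σ : SignType) :
    F '' U ∩ side σ V F = F '' (U ∩ interior (closedSide σ)) := by
  rw [side, ← hF.injective.image_inter hU inter_subset_right, inter_comm _ V, ← inter_assoc,
    inter_eq_left.2 hU]

theorem isOpen_image (hF : IsAnalyticExtension γ V F) (hU : IsOpen U) (hUV : U ⊆ V) :
    IsOpen (F '' U) :=
  isOpen_image_of_injOn hF.holomorphic hF.injective hU hUV

theorem continuous_of_pullback (hF : IsAnalyticExtension γ V F) {hab : a < b} {u : range γ → ℂ}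
    (hu : ContinuousOn (pullback hab γ u) (Icc a b)) : Continuous u := by
  have hc : Continuous (rangeFactorization γ) := hF.continuous_curve.subtype_mk _
  refine (hc.isClosedMap.isQuotientMap hc rangeFactorization_surjective).continuous_iff.2 ?_
  exact (continuousOn_iff_continuous_domRestrict.1 hu).congr (pullback_coe hab u)

theorem exists_mem_extendable (hF : IsAnalyticExtension γ V F) (hab : a < b) {σ : SignType}
    {u : range γ → ℂ} (hu : ExtendableFromSide γ (side σ V F) u) :
    ∃ c r, 0 < r ∧ ball c r ⊆ Icc a b ∧ ball (c : ℂ) r ⊆ V ∧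
      pullback hab γ u ∈ extendable σ c r := by
  obtain ⟨W, hW, -, ⟨_, htW, t, rfl⟩, g, hgc, hgd, hgu⟩ := hu
  have hN : IsOpen (V ∩ F ⁻¹' W) := hF.holomorphic.continuousOn.isOpen_inter_preimage hF.isOpen hW
  obtain ⟨c, r, hr, hI, hball⟩ := exists_ball_subset_Icc hab t.2
    (hN.mem_nhds ⟨hF.mem t, by rwa [mem_preimage, hF.eq_curve]⟩)
  have hinterior : MapsTo F (ball (c : ℂ) r ∩ interior (closedSide σ)) (W ∩ side σ V F) :=
    fun z hz => ⟨(hball hz.1).2, z, ⟨hz.2, (hball hz.1).1⟩, rfl⟩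
  have hcurve {x : ℝ} (hx : x ∈ ball c r) : F x = γ ⟨x, hI hx⟩ := hF.eq_curve ⟨x, hI hx⟩
  have hd : DifferentiableOn ℂ F (ball (c : ℂ) r) := hF.holomorphic.mono fun z hz => (hball hz).1
  refine ⟨c, r, hr, hI, fun z hz => (hball hz).1, g ∘ F, ?_, ?_, fun x hx => ?_⟩
  · refine hgc.comp (hd.continuousOn.mono inter_subset_left) fun z hz => ?_
    rcases mem_interior_closedSide_or_exists_ofReal hz.2 with h | ⟨x, rfl⟩
    · exact .inr (hinterior ⟨hz.1, h⟩)
    · exact .inl ⟨_, (hcurve (ofReal_mem_ball.1 hz.1)).symm⟩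
  · exact hgd.comp (hd.mono inter_subset_left) hinterior
  · have hxW : F x ∈ W := (hball (ofReal_mem_ball.2 hx)).2
    rw [Function.comp_apply, hcurve hx, pullback_coe hab u ⟨x, hI hx⟩]
    rw [hcurve hx] at hxW
    exact hgu ⟨_, mem_range_self _⟩ hxW

theorem exists_extension_on_image (hF : IsAnalyticExtension γ V F) (hab : a < b)
    {σ : SignType} {u : range γ → ℂ} {c r : ℝ} (hV : ball (c : ℂ) r ⊆ V)
    (hext : pullback hab γ u ∈ extendable σ c r) :
    ∃ H, ContinuousOn H (F '' (ball (c : ℂ) r ∩ closedSide σ)) ∧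
      DifferentiableOn ℂ H (F '' (ball (c : ℂ) r ∩ interior (closedSide σ))) ∧
      ∀ w : range γ, (w : ℂ) ∈ F '' ball (c : ℂ) r → H w = u w := by
  obtain ⟨G, hG⟩ := hext
  let Φ := Function.invFunOn F V
  have hΦ : LeftInvOn Φ F V := hF.injective.leftInvOn_invFunOn
  have hΦd : DifferentiableOn ℂ Φ (F '' V) :=
    differentiableOn_leftInverse hF.isOpen hF.holomorphic hF.injective hΦ
  have hmaps {U : Set ℂ} (hU : U ⊆ V) : MapsTo Φ (F '' U) U := by
    rintro _ ⟨z, hz, rfl⟩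
    rwa [hΦ (hU hz)]
  have hsub (A : Set ℂ) : ball (c : ℂ) r ∩ A ⊆ V := inter_subset_left.trans hV
  refine ⟨G ∘ Φ, hG.continuousOn.comp (hΦd.continuousOn.mono (image_mono (hsub _)))
    (hmaps (hsub _)), hG.differentiableOn.comp (hΦd.mono (image_mono (hsub _)))
    (hmaps (hsub _)), ?_⟩
  rintro ⟨_, t, rfl⟩ hw
  rw [hF.curve_mem_image_iff hV, ofReal_mem_ball] at hw
  have hΦt : Φ (γ t) = (t : ℝ) := by rw [← hF.eq_curve, hΦ (hF.mem t)]
  rw [Function.comp_apply, hΦt, hG.eq_ofReal _ hw]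
  exact pullback_coe hab u t

theorem extendableFromSide_of_mem_extendable (hF : IsAnalyticExtension γ V F) {hab : a < b}
    {σ : SignType} {u : range γ → ℂ} (hu : Continuous u) {c r : ℝ} (hr : 0 < r)
    (hI : ball c r ⊆ Icc a b) (hV : ball (c : ℂ) r ⊆ V)
    (hext : pullback hab γ u ∈ extendable σ c r) : ExtendableFromSide γ (side σ V F) u := by
  obtain ⟨H, hHc, hHd, hHu⟩ := hF.exists_extension_on_image hab hV hext
  have hhalf : closedBall (c : ℂ) (r / 2) ⊆ ball (c : ℂ) r := closedBall_subset_ball (by linarith)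
  have hball : ball (c : ℂ) (r / 2) ⊆ ball (c : ℂ) r := ball_subset_closedBall.trans hhalf
  have hcompact : IsCompact (F '' closedBall (c : ℂ) (r / 2)) :=
    (isCompact_closedBall _ _).image_of_continuousOn
      (hF.holomorphic.continuousOn.mono (hhalf.trans hV))
  have hside : F '' ball (c : ℂ) (r / 2) ∩ side σ V F ⊆
      F '' (ball (c : ℂ) r ∩ interior (closedSide σ)) := by
    rw [hF.image_inter_side (hball.trans hV)]
    exact image_mono (inter_subset_inter_left _ hball)
  have hunion : (range γ ∪ F '' ball (c : ℂ) (r / 2) ∩ side σ V F) ∩ F '' ball (c : ℂ) r ⊆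
      F '' (ball (c : ℂ) r ∩ closedSide σ) := by
    rintro _ ⟨⟨t, rfl⟩ | hw, hO⟩
    · rw [hF.curve_mem_image_iff hV] at hO
      exact ⟨t, ⟨hO, ofReal_mem_closedSide σ t⟩, hF.eq_curve t⟩
    · exact image_mono (inter_subset_inter_right _ interior_subset) (hside hw)
  obtain ⟨g, hgc, hgH, hgu⟩ := exists_continuousOn_union_extension hcompact.isClosed
    (hF.isOpen_image isOpen_ball hV) (inter_subset_left.trans (image_mono ball_subset_closedBall))
    (image_mono hhalf) hu (hHc.mono hunion) hHu
  refine ⟨F '' ball (c : ℂ) (r / 2), hF.isOpen_image isOpen_ball (hball.trans hV),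
    (isConnected_ball (half_pos hr)).image F (hF.holomorphic.continuousOn.mono (hball.trans hV)),
    ⟨F c, mem_image_of_mem F (mem_ball_self (half_pos hr)), ?_⟩, g, hgc,
    (hHd.mono hside).congr hgH, fun w _ => hgu w⟩
  exact ⟨⟨c, hI (mem_ball_self hr)⟩, (hF.eq_curve _).symm⟩

theorem extendableToDisc_iff (hF : IsAnalyticExtension γ V F) {u : range γ → ℂ}
    (hu : Continuous u) : ExtendableToDisc γ u ↔ ExtendableFromSide γ (side 0 V F) u := by
  rw [side_zero]
  constructor
  · rintro ⟨z₀, hz₀, r, hr, f, hfd, hfu⟩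
    have hhalf : closedBall z₀ (r / 2) ⊆ ball z₀ r := closedBall_subset_ball (by linarith)
    obtain ⟨g, hgc, hgf, hgu⟩ := exists_continuousOn_union_extension
      (T := ball z₀ (r / 2) ∩ F '' V) isClosed_closedBall isOpen_ball
      (inter_subset_left.trans ball_subset_closedBall) hhalf hu
      (hfd.continuousOn.mono inter_subset_right) hfu
    exact ⟨ball z₀ (r / 2), isOpen_ball, isConnected_ball (half_pos hr),
      ⟨z₀, mem_ball_self (half_pos hr), hz₀⟩, g, hgc,
      (hfd.mono (inter_subset_left.trans (ball_subset_closedBall.trans hhalf))).congr hgf,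
      fun w _ => hgu w⟩
  · rintro ⟨W, hW, -, ⟨z₀, hz₀W, hz₀⟩, g, -, hgd, hgu⟩
    obtain ⟨r, hr, hball⟩ := Metric.isOpen_iff.1
      (hW.inter (hF.isOpen_image hF.isOpen subset_rfl)) z₀ ⟨hz₀W, hF.range_subset_image hz₀⟩
    exact ⟨z₀, hz₀, r, hr, g, hgd.mono hball, fun w hw => hgu w (hball hw).1⟩

end IsAnalyticExtension

end Transfer

section Topology

/-- On a line in a direction lying in none of the subspaces, each subspace excludes at most one
point. -/
theorem dense_setOf_forall_notMem_submodule {𝕜 X ι : Type*} [NontriviallyNormedField 𝕜]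
    [CompleteSpace 𝕜] [AddCommGroup X] [Module 𝕜 X] [TopologicalSpace X] [ContinuousAdd X]
    [ContinuousSMul 𝕜 X] [Countable ι] {p : ι → Submodule 𝕜 X} {x₀ : X} (hx₀ : ∀ i, x₀ ∉ p i) :
    Dense {x | ∀ i, x ∉ p i} := by
  intro x
  let line : 𝕜 → X := fun t => x + t • x₀
  have hline : Continuous line := by fun_prop
  have hsub (i : ι) : (line ⁻¹' p i).Subsingleton := by
    intro s hs t ht
    by_contra hst
    have hdiff : line s - line t = (s - t) • x₀ := by simp only [line, sub_smul]; abel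
    have hmem : (s - t) • x₀ ∈ p i := hdiff ▸ (p i).sub_mem hs ht
    exact hx₀ i (((p i).smul_mem_iff (sub_ne_zero.2 hst)).1 hmem)
  have hcountable : (⋃ i, line ⁻¹' p i).Countable := countable_iUnion fun i => (hsub i).countable
  have hx : line 0 = x := by simp [line]
  rw [← hx]
  refine closure_mono ?_ (image_closure_subset_closure_image hline
    (mem_image_of_mem line (hcountable.dense_compl 𝕜 0)))
  rintro _ ⟨t, ht, rfl⟩ i hi
  exact ht (mem_iUnion.2 ⟨i, hi⟩)

theorem isGδ_compl_of_forall_closure {X Y ι : Type*} [TopologicalSpace X] [TopologicalSpace Y]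
    [Countable ι] {f : X → Y} (hf : Continuous f) {E : Set X} {S : ι → Set Y}
    (hES : ∀ x ∈ E, ∃ i, f x ∈ S i) (hSE : ∀ i x, f x ∈ closure (S i) → x ∈ E) : IsGδ Eᶜ := by
  have hE : E = ⋃ i, f ⁻¹' closure (S i) := by
    ext x
    simp only [mem_iUnion, mem_preimage]
    exact ⟨fun hx => (hES x hx).imp fun i hi => subset_closure hi, fun ⟨i, hi⟩ => hSE i x hi⟩
  rw [hE, compl_iUnion]
  exact .iInter_of_isOpen fun i => (isClosed_closure.preimage hf).isOpen_compl

theorem tendstoUniformly_IccExtend {Y : Type*} [PseudoMetricSpace Y] {a b : ℝ} (hab : a ≤ b)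
    {w : ℕ → C(Icc a b, Y)} {w₀ : C(Icc a b, Y)} (h : Tendsto w atTop (𝓝 w₀)) :
    TendstoUniformly (fun n => IccExtend hab (w n)) (IccExtend hab w₀) atTop :=
  (ContinuousMap.tendsto_iff_tendstoUniformly.1 h).comp (projIcc a b hab)

end Topology

namespace Ck

variable {a b : ℝ} {hab : a < b} {γ : Icc a b → ℂ} {V : Set ℂ} {F : ℂ → ℂ} {k : ℕ∞}

theorem withSeminorms : WithSeminorms (Ck.seminorms hab γ k) := ⟨rfl⟩

instance : Nonempty {l : ℕ // (l : ℕ∞) ≤ k} := ⟨⟨0, by simp⟩⟩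

instance : IsTopologicalAddGroup (Ck hab γ k) := withSeminorms.topologicalAddGroup

instance : ContinuousSMul ℂ (Ck hab γ k) := withSeminorms.continuousSMul

/-- The map `u ↦ u ∘ γ` into the continuous functions on `[a, b]`, as the derivative of
order `0`. -/
noncomputable def compCurve : Ck hab γ k →ₗ[ℂ] C(Icc a b, ℂ) := derivMap ⟨0, by simp⟩

theorem continuous_compCurve : Continuous (compCurve : Ck hab γ k →ₗ[ℂ] C(Icc a b, ℂ)) := by
  refine WithSeminorms.continuous_normedSpace_rng _ withSeminorms _ ⟨{⟨0, by simp⟩}, 1, ?_⟩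
  rw [Finset.sup_singleton, one_smul]
  exact le_rfl

theorem IccExtend_compCurve (u : Ck hab γ k) :
    IccExtend hab.le (compCurve u) = pullback hab γ u.toFun := by
  refine congr_arg (IccExtend hab.le) (funext fun t => ?_)
  calc compCurve u t = iteratedDerivWithin 0 (pullback hab γ u.toFun) (Icc a b) t := rfl
    _ = u.toFun ⟨γ t, mem_range_self t⟩ := by rw [iteratedDerivWithin_zero, pullback_coe]

theorem continuous_toFun (hF : IsAnalyticExtension γ V F) (u : Ck hab γ k) :
    Continuous u.toFun :=
  hF.continuous_of_pullback u.contDiffOn.continuousOn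

/-- The map `u ↦ u ∘ γ`, continued by constants to `ℝ`, as a linear map. -/
noncomputable def pullbackLinear : Ck hab γ k →ₗ[ℂ] ℝ → ℂ where
  toFun u := pullback hab γ u.toFun
  map_add' _ _ := rfl
  map_smul' _ _ := rfl

theorem exists_eqOn_pullbackLinear (hF : IsAnalyticExtension γ V F) {v : ℝ → ℂ}
    (hv : ContDiffOn ℝ k v (Icc a b)) :
    ∃ u : Ck hab γ k, EqOn (pullbackLinear u) v (Icc a b) := by
  let u : range γ → ℂ := fun z => v (rangeSplitting γ z : Icc a b)
  have hu : EqOn (pullback hab γ u) v (Icc a b) := by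
    intro x hx
    have ht : rangeSplitting γ ⟨γ ⟨x, hx⟩, mem_range_self _⟩ = ⟨x, hx⟩ :=
      hF.injective_curve (apply_rangeSplitting γ _)
    calc pullback hab γ u x = u ⟨γ ⟨x, hx⟩, mem_range_self _⟩ := pullback_coe hab u ⟨x, hx⟩
      _ = v x := congr_arg (fun t : Icc a b => v t) ht
  exact ⟨⟨u, hv.congr hu⟩, hu⟩

theorem isGδ_not_extendableFromSide (hF : IsAnalyticExtension γ V F) (σ : SignType) :
    IsGδ {u : Ck hab γ k | ¬ ExtendableFromSide γ (side σ V F) u.toFun} := by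
  refine isGδ_compl_of_forall_closure
    (ι := {i : ℚ × ℚ × ℕ //
      0 < i.2.1 ∧ ball (i.1 : ℝ) i.2.1 ⊆ Icc a b ∧ ball ((i.1 : ℝ) : ℂ) i.2.1 ⊆ V})
    (S := fun i => {w | IccExtend hab.le w ∈ boundedlyExtendable σ i.1.1 i.1.2.1 i.1.2.2})
    continuous_compCurve (fun u hu => ?_) fun i u hu => ?_
  · obtain ⟨c, r, hr, hI, hV, hext⟩ := hF.exists_mem_extendable hab hu
    obtain ⟨d, s, M, hs, hds, hmem⟩ := exists_rat_mem_boundedlyExtendable hext hr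
    refine ⟨⟨(d, s, M), hs, (ball_subset_ball' hds).trans hI,
      (ball_subset_ball' (by rwa [Complex.isometry_ofReal.dist_eq])).trans hV⟩, ?_⟩
    rwa [mem_ofPred_eq, IccExtend_compCurve]
  · obtain ⟨w, hw, hlim⟩ := mem_closure_iff_seq_limit.1 hu
    obtain ⟨hs, hI, hV⟩ := i.2
    have hs' : (0 : ℝ) < i.1.2.1 := by exact_mod_cast hs
    have hext := mem_extendable_of_tendstoUniformlyOn hs' hw
      (tendstoUniformly_IccExtend hab.le hlim).tendstoUniformlyOn
    rw [IccExtend_compCurve] at hext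
    have hquarter : (i.1.2.1 / 4 : ℝ) ≤ i.1.2.1 := by linarith
    exact hF.extendableFromSide_of_mem_extendable (u.continuous_toFun hF) (by positivity)
      ((ball_subset_ball hquarter).trans hI) ((ball_subset_ball hquarter).trans hV) hext

theorem dense_forall_not_extendableFromSide (hF : IsAnalyticExtension γ V F) :
    Dense (⋂ σ, {u : Ck hab γ k | ¬ ExtendableFromSide γ (side σ V F) u.toFun}) := by
  obtain ⟨v, hv, hne⟩ := exists_contDiff_forall_notMem_extendable
  obtain ⟨u₀, hu₀⟩ := exists_eqOn_pullbackLinear (hab := hab) (k := k) hF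
    (hv.contDiffOn.of_le (by exact_mod_cast le_top))
  have hdense := dense_setOf_forall_notMem_submodule
    (ι := {i : SignType × ℚ × ℚ // 0 < i.2.2 ∧ ball (i.2.1 : ℝ) i.2.2 ⊆ Icc a b})
    (p := fun i => (extendable i.1.1 i.1.2.1 i.1.2.2).comap pullbackLinear) (x₀ := u₀)
    fun i hmem => hne _ _ _ (by exact_mod_cast i.2.1)
      ((mem_extendable_congr (hu₀.mono i.2.2)).1 hmem)
  refine hdense.mono fun u hu => mem_iInter.2 fun σ hext => ?_
  obtain ⟨c, r, hr, hI, -, hmem⟩ := hF.exists_mem_extendable hab hext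
  obtain ⟨d, s, M, hs, hds, hmem⟩ := exists_rat_mem_boundedlyExtendable hmem hr
  exact hu ⟨(σ, d, s), hs, (ball_subset_ball' hds).trans hI⟩
    (boundedlyExtendable_subset_extendable hmem)

end Ck

section NonextendableSets

variable {a b : ℝ} {γ : Icc a b → ℂ} {V : Set ℂ} {F : ℂ → ℂ}

theorem U₂_eq (hab : a < b) (γ : Icc a b → ℂ) (V : Set ℂ) (F : ℂ → ℂ) (k : ℕ∞) :
    U₂ hab γ V F k = {u | ¬ ExtendableFromSide γ (side 1 V F) u.toFun} := by
  rw [side_one, U₂]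

theorem U₃_eq (hab : a < b) (γ : Icc a b → ℂ) (V : Set ℂ) (F : ℂ → ℂ) (k : ℕ∞) :
    U₃ hab γ V F k = {u | ¬ ExtendableFromSide γ (side (-1) V F) u.toFun} := by
  rw [side_neg_one, U₃]

theorem U₄_eq_inter (hab : a < b) (γ : Icc a b → ℂ) (V : Set ℂ) (F : ℂ → ℂ) (k : ℕ∞) :
    U₄ hab γ V F k = U₂ hab γ V F k ∩ U₃ hab γ V F k := rfl

theorem U₅_eq (hF : IsAnalyticExtension γ V F) (hab : a < b) (k : ℕ∞) :
    U₅ hab γ k = {u | ¬ ExtendableFromSide γ (side 0 V F) u.toFun} := by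
  ext u
  exact not_congr (hF.extendableToDisc_iff (u.continuous_toFun hF))

end NonextendableSets

end AnalyticArc

theorem theorem4p35 {a b : ℝ} (hab : a < b) (γ : Set.Icc a b → ℂ) (V : Set ℂ) (F : ℂ → ℂ)
    (hF : AnalyticArc.IsAnalyticExtension γ V F) (k : ℕ∞) :
    (Dense (AnalyticArc.U₂ hab γ V F k) ∧ IsGδ (AnalyticArc.U₂ hab γ V F k)) ∧
    (Dense (AnalyticArc.U₃ hab γ V F k) ∧ IsGδ (AnalyticArc.U₃ hab γ V F k)) ∧
    (Dense (AnalyticArc.U₄ hab γ V F k) ∧ IsGδ (AnalyticArc.U₄ hab γ V F k)) ∧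
    (Dense (AnalyticArc.U₅ hab γ k) ∧ IsGδ (AnalyticArc.U₅ hab γ k)) := by
  have hdense := AnalyticArc.Ck.dense_forall_not_extendableFromSide (hab := hab) (k := k) hF
  have hGδ := AnalyticArc.Ck.isGδ_not_extendableFromSide (hab := hab) (k := k) hF
  rw [AnalyticArc.U₄_eq_inter, AnalyticArc.U₂_eq, AnalyticArc.U₃_eq, AnalyticArc.U₅_eq hF]
  exact ⟨⟨hdense.mono (Set.iInter_subset _ 1), hGδ 1⟩,
    ⟨hdense.mono (Set.iInter_subset _ (-1)), hGδ (-1)⟩,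
    ⟨hdense.mono (Set.subset_inter (Set.iInter_subset _ 1) (Set.iInter_subset _ (-1))),
      (hGδ 1).inter (hGδ (-1))⟩,
    ⟨hdense.mono (Set.iInter_subset _ 0), hGδ 0⟩⟩
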